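/- Let $k>1$ be a square-free integer, $k_0=2$ if $k\equiv 1 \bmod 4$ and $k_0=1$ otherwise, $\omega=\frac{1+\sqrt k}{k_0}$, $\omega'=\frac{1-\sqrt k}{k_0}$, and let $R=\mathbb Z[\omega]$ be the ring of integers of $\mathbb Q(\sqrt k)$, with conjugation $\alpha\mapsto\alpha'$ and fundamental unit $\epsilon_0$ (the smallest unit of $R$ greater than $1$). Let $\Gamma=\mathrm{PSL}_2(R)$ act on $\mathbb H^2\times\mathbb H^2$ by $A\cdot(Z_1,Z_2)=(A\cdot Z_1,A'\cdot Z_2)$ (Möbius transformations in each component). For $Z=(x_1+y_1i,x_2+y_2i)$ put $$s_1=\frac{\omega'x_1-\omega x_2}{\omega'-\omega},\quad s_2=\frac{x_1-x_2}{\omega-\omega'},\quad r=\frac{y_1}{y_2},\quad \Vert cZ+d\Vert=\big((cx_1+d)^2+c^2y_1^2\big)\big((c'x_2+d')^2+c'^2y_2^2\big)\ (c,d\in R),$$ and let $\mathcal F$ be the set of all $Z$ with $|s_1|,|s_2|\le\frac12$, $\epsilon_0^{-2}\le r\le\epsilon_0^2$, and $\Vert cZ+d\Vert\ge1$ for all $c,d\in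 R$ with $cR+dR=R$. The sets $\gamma(\mathcal F)$, $\gamma\in\Gamma$, are called tiles. Dimension means the dimension of semi-algebraic subsets of $\mathbb R^4$ (coordinates $x_1,x_2,y_1,y_2$). A cell is a non-empty intersection $C$ of tiles such that for every $\gamma\in\Gamma$ either $C\subseteq\gamma(\mathcal F)$ or $\dim(C\cap\gamma(\mathcal F))<\dim C$; an edge is a cell of dimension $2$; a cell or edge of $\mathcal F$ is one that is contained in $\mathcal F$. For $1\ne\gamma\in\Gamma$ let $S_\gamma=\mathcal F\cap\gamma^{-1}(\mathcal F)$; if $\dim S_\gamma=3$, then $S_\gamma$ is called a side of $\mathcal F$ and $\gamma$ a pairing transformation; put $S_\gamma^*=S_{\gamma^{-1}}$. A cycle is a sequence $(E_1,S_1,\dots,E_n,S_n)$, $n\geq 1$, with $S_i=S_{\gamma_i}$ for pairing transformations $\gamma_i$, obtained as follows: $E_1$ is an edge of $\mathcal F$ contained in the side $S_1$ of $\mathcal F$, and recursively $E_{i+1}=\gamma_i(E_i)$ and $S_{i+1}$ is the only side of $\mathcal F$ different from $S_i^*$ that contains $E_{i+1}$; the resulting infinite sequence (including that of the $\gamma_i$)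 is periodic with period $n$ and the pairs $(E_1,S_1),\dots,(E_n,S_n)$ are distinct. Consider the presentation with one generator $[\gamma]$ for each pairing transformation $\gamma$, with the pairing relations $[\gamma][\gamma^{-1}]=1$ for each pairing transformation $\gamma$, and with the cycle relations $([\gamma_n]\cdots[\gamma_1])^m=1$ for each cycle, where $m$ is the order of $\gamma_n\cdots\gamma_1$ in $\Gamma$. If $R$ is a principal ideal domain, then every tile intersects only finitely many other tiles. In particular, $\mathcal F$ has only finitely many cells, only finitely many sides and only finitely many edges, and the above presentation is finite: it has finitely many generators and finitely many relations. -/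

import Mathlib

open UpperHalfPlane

noncomputable section

namespace HilbertModular

/-! ### The real quadratic ring `R = ℤ[ω]` -/

/-- `k₀ = 2` if `k ≡ 1 mod 4` and `k₀ = 1` otherwise. -/
def kZero (k : ℕ) : ℕ := if k % 4 = 1 then 2 else 1

/-- `ω = (1 + √k) / k₀`. -/
def omegaR (k : ℕ) : ℝ := (1 + √(k : ℝ)) / kZero k

/-- `ω' = (1 - √k) / k₀`. -/
def omegaR' (k : ℕ) : ℝ := (1 - √(k : ℝ)) / kZero k

/-- The ring `R = ℤ[ω]`, the ring of integers of `ℚ(√k)`: its elements are the formal sums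
`α₀ + α₁ ω` with `α₀, α₁ ∈ ℤ`, multiplied by the rule `ω² = (k - 1) / k₀² + (2 / k₀) ω`
(both coefficients are integers, the divisions are exact). -/
abbrev QuadInt (k : ℕ) : Type :=
  QuadraticAlgebra ℤ (((k : ℤ) - 1) / (kZero k : ℤ) ^ 2) (2 / (kZero k : ℤ))

theorem omegaR_mul_self (k : ℕ) :
    omegaR k * omegaR k =
      (((k : ℤ) - 1) / (kZero k : ℤ) ^ 2) • (1 : ℝ) + (2 / (kZero k : ℤ)) • omegaR k := by
  have hs : √(k : ℝ) * √(k : ℝ) = k := Real.mul_self_sqrt (Nat.cast_nonneg k)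
  by_cases h : k % 4 = 1
  · obtain ⟨m, hm⟩ : ∃ m : ℕ, k = 4 * m + 1 := ⟨k / 4, by omega⟩
    have e : ((k : ℤ) - 1) / (2 : ℤ) ^ 2 = m := by subst hm; push_cast; omega
    have hk : (k : ℝ) = 4 * m + 1 := by rw [hm]; push_cast; ring
    simp only [omegaR, kZero, h, if_true, Nat.cast_ofNat, e]
    norm_num
    linarith [hs, hk]
  · simp only [omegaR, kZero, h, if_false]
    norm_num
    linarith [hs]

theorem omegaR'_mul_self (k : ℕ) :
    omegaR' k * omegaR' k =
      (((k : ℤ) - 1) / (kZero k : ℤ) ^ 2) • (1 : ℝ) + (2 / (kZero k : ℤ)) • omegaR' k := by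
  have hs : √(k : ℝ) * √(k : ℝ) = k := Real.mul_self_sqrt (Nat.cast_nonneg k)
  by_cases h : k % 4 = 1
  · obtain ⟨m, hm⟩ : ∃ m : ℕ, k = 4 * m + 1 := ⟨k / 4, by omega⟩
    have e : ((k : ℤ) - 1) / (2 : ℤ) ^ 2 = m := by subst hm; push_cast; omega
    have hk : (k : ℝ) = 4 * m + 1 := by rw [hm]; push_cast; ring
    simp only [omegaR', kZero, h, if_true, Nat.cast_ofNat, e]
    norm_num
    linarith [hs, hk]
  · simp only [omegaR', kZero, h, if_false]
    norm_num
    linarith [hs]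

/-- The inclusion `R → ℝ`, `α₀ + α₁ ω ↦ α₀ + α₁ ω`. -/
def emb (k : ℕ) : QuadInt k →+* ℝ :=
  (QuadraticAlgebra.lift ⟨omegaR k, omegaR_mul_self k⟩ : QuadInt k →ₐ[ℤ] ℝ).toRingHom

/-- The conjugate embedding `R → ℝ`, `α ↦ α'`, that is `α₀ + α₁ ω ↦ α₀ + α₁ ω'`. -/
def emb' (k : ℕ) : QuadInt k →+* ℝ :=
  (QuadraticAlgebra.lift ⟨omegaR' k, omegaR'_mul_self k⟩ : QuadInt k →ₐ[ℤ] ℝ).toRingHom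

/-- The fundamental unit `ε₀`: the smallest unit of `R` that is greater than `1`. -/
def fundUnit (k : ℕ) : ℝ := sInf {x : ℝ | 1 < x ∧ ∃ u : (QuadInt k)ˣ, emb k u = x}

/-! ### The Hilbert modular group and its action on `ℍ × ℍ` -/

/-- The Hilbert modular group `Γ = PSL₂(R)`. -/
abbrev Gam (k : ℕ) : Type := Matrix.ProjectiveSpecialLinearGroup (Fin 2) (QuadInt k)

/-- The action of `SL₂(R)` on `ℍ × ℍ`: the matrix `A` acts by the pair `(A, A')` of real
matrices, by Möbius transformations in each component. -/
def actSL (k : ℕ) :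
    Matrix.SpecialLinearGroup (Fin 2) (QuadInt k) →* Equiv.Perm (ℍ × ℍ) where
  toFun A := Equiv.prodCongr
    (MulAction.toPerm (Matrix.SpecialLinearGroup.map (emb k) A))
    (MulAction.toPerm (Matrix.SpecialLinearGroup.map (emb' k) A))
  map_one' := by ext z <;> simp
  map_mul' A B := by ext z <;> simp [mul_smul]

theorem smul_eq_of_center {S : Type*} [CommRing S] (f : S →+* ℝ)
    {A : Matrix.SpecialLinearGroup (Fin 2) S}
    (hA : A ∈ Subgroup.center (Matrix.SpecialLinearGroup (Fin 2) S)) (z : ℍ) :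
    Matrix.SpecialLinearGroup.map f A • z = z := by
  obtain ⟨r, hr, h⟩ := Matrix.SpecialLinearGroup.mem_center_iff.mp hA
  have hr' : f r * f r = 1 := by
    rw [← map_mul, ← pow_two, ← Fintype.card_fin 2, hr, map_one]
  have hne : f r ≠ 0 := fun h0 => by simp [h0] at hr'
  have h00 : A.1 0 0 = r := by rw [← h]; simp
  have h01 : A.1 0 1 = 0 := by rw [← h]; simp
  have h10 : A.1 1 0 = 0 := by rw [← h]; simp
  have h11 : A.1 1 1 = r := by rw [← h]; simp
  ext
  rw [UpperHalfPlane.coe_specialLinearGroup_apply]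
  simp [h00, h01, h10, h11, hne]

/-- The action of `Γ = PSL₂(R)` on `ℍ × ℍ` induced by that of `SL₂(R)`. -/
def act (k : ℕ) : Gam k →* Equiv.Perm (ℍ × ℍ) :=
  QuotientGroup.lift _ (actSL k) fun A hA => by
    ext z <;> simp [actSL, smul_eq_of_center _ hA]

/-! ### The fundamental domain and its tessellation -/

/-- The coordinate `s₁ = (ω' x₁ - ω x₂) / (ω' - ω)` on `ℍ × ℍ`. -/
def sOne (k : ℕ) (Z : ℍ × ℍ) : ℝ :=
  (omegaR' k * Z.1.re - omegaR k * Z.2.re) / (omegaR' k - omegaR k)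

/-- The coordinate `s₂ = (x₁ - x₂) / (ω - ω')` on `ℍ × ℍ`. -/
def sTwo (k : ℕ) (Z : ℍ × ℍ) : ℝ := (Z.1.re - Z.2.re) / (omegaR k - omegaR' k)

/-- The ratio `r = y₁ / y₂`. -/
def ratio (Z : ℍ × ℍ) : ℝ := Z.1.im / Z.2.im

/-- `‖cZ + d‖ = ((c x₁ + d)² + c² y₁²) ((c' x₂ + d')² + c'² y₂²)`. -/
def normCD (k : ℕ) (c d : QuadInt k) (Z : ℍ × ℍ) : ℝ :=
  ((emb k c * Z.1.re + emb k d) ^ 2 + emb k c ^ 2 * Z.1.im ^ 2) *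
    ((emb' k c * Z.2.re + emb' k d) ^ 2 + emb' k c ^ 2 * Z.2.im ^ 2)

/-- `F_∞`: the points with `|s₁|, |s₂| ≤ 1/2` and `ε₀⁻² ≤ r ≤ ε₀²`. -/
def FInf (k : ℕ) : Set (ℍ × ℍ) :=
  {Z | |sOne k Z| ≤ 1 / 2 ∧ |sTwo k Z| ≤ 1 / 2 ∧
    (fundUnit k ^ 2)⁻¹ ≤ ratio Z ∧ ratio Z ≤ fundUnit k ^ 2}

/-- `F_0`: the points with `‖cZ + d‖ ≥ 1` for all `c, d ∈ R` with `cR + dR = R`. -/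
def FZero (k : ℕ) : Set (ℍ × ℍ) :=
  {Z | ∀ c d : QuadInt k, IsCoprime c d → 1 ≤ normCD k c d Z}

/-- The fundamental domain `F = F_∞ ∩ F_0` of `Γ`. -/
def FDom (k : ℕ) : Set (ℍ × ℍ) := FInf k ∩ FZero k

/-- The tile `γ(F)`. -/
def tile (k : ℕ) (γ : Gam k) : Set (ℍ × ℍ) := act k γ '' FDom k

/-- The tessellation `{γ(F) : γ ∈ Γ}`. -/
def tessellation (k : ℕ) : Set (Set (ℍ × ℍ)) := Set.range (tile k)

/-! ### Dimension, cells, sides, edges -/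

/-- The real coordinates `(x₁, x₂, y₁, y₂)` of a point of `ℍ × ℍ`. -/
def coords (Z : ℍ × ℍ) : Fin 4 → ℝ := ![Z.1.re, Z.2.re, Z.1.im, Z.2.im]

/-- The dimension of a semi-algebraic subset `A` of `ℍ × ℍ ⊆ ℝ⁴`, as in real algebraic geometry:
the Krull dimension of `ℝ[X₁, …, X₄] / I(A)`, where `I(A)` is the ideal of the polynomials that
vanish on `A`. The empty set has dimension `⊥`. -/
def semialgDim (A : Set (ℍ × ℍ)) : WithBot ℕ∞ :=
  ringKrullDim (MvPolynomial (Fin 4) ℝ ⧸ MvPolynomial.vanishingIdeal ℝ (coords '' A))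

/-- A cell of the tessellation: a non-empty intersection `C` of tiles such that, for every
`γ ∈ Γ`, either `C ⊆ γ(F)` or `C ∩ γ(F)` has smaller dimension than `C`. -/
def IsCell (k : ℕ) (C : Set (ℍ × ℍ)) : Prop :=
  C.Nonempty ∧ (∃ I : Set (Gam k), I.Nonempty ∧ C = ⋂ γ ∈ I, tile k γ) ∧
    ∀ γ : Gam k, C ⊆ tile k γ ∨ semialgDim (C ∩ tile k γ) < semialgDim C

/-- An edge of the tessellation: a cell of dimension `2`. -/
def IsEdge (k : ℕ) (E : Set (ℍ × ℍ)) : Prop := IsCell k E ∧ semialgDim E = 2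

/-- `S_γ = F ∩ γ⁻¹(F)`. -/
def sideSet (k : ℕ) (γ : Gam k) : Set (ℍ × ℍ) := FDom k ∩ tile k γ⁻¹

/-- `γ ≠ 1` is a pairing transformation of `F` if `S_γ` has dimension `3`. -/
def IsPairing (k : ℕ) (γ : Gam k) : Prop := γ ≠ 1 ∧ semialgDim (sideSet k γ) = 3

/-- A side of `F`: a set of the form `S_γ`, with `γ ≠ 1`, that has dimension `3`. -/
def IsSide (k : ℕ) (S : Set (ℍ × ℍ)) : Prop := ∃ γ : Gam k, IsPairing k γ ∧ S = sideSet k γ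

/-! ### The presentation: pairing transformations, pairing relations, cycle relations -/

/-- The generators of the presentation: the pairing transformations of `F`. -/
abbrev Pairing (k : ℕ) : Type := {γ : Gam k // IsPairing k γ}

/-- The pairing relators `[γ][γ⁻¹]`, for `γ` a pairing transformation (so that `S_{γ⁻¹} = S_γ^*`
is the side paired with `S_γ`). -/
def pairingRelators (k : ℕ) : Set (FreeGroup (Pairing k)) :=
  {w | ∃ γ δ : Pairing k, (δ : Gam k) = (γ : Gam k)⁻¹ ∧ w = FreeGroup.of γ * FreeGroup.of δ}

/-- `(E 0, S 0, E 1, S 1, …, E (n-1), S (n-1))` is a cycle of `F`, where `S i = S_{g i}`: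
`E 0` is an edge contained in the side `S 0` of `F`, `E (i+1)` is the image of `E i` under `g i`,
`S (i+1)` is the only side of `F` that contains `E (i+1)` and differs from the side
`(S i)^* = S_{(g i)⁻¹}`, the sequence has period `n ≥ 1`, and the `n` pairs `(E i, S i)` with
`i < n` are distinct. -/
structure IsCycle (k n : ℕ) (E : ℕ → Set (ℍ × ℍ)) (g : ℕ → Pairing k) : Prop where
  pos : 0 < n
  edge : IsEdge k (E 0)
  subset : E 0 ⊆ sideSet k (g 0)
  image : ∀ i, E (i + 1) = act k (g i) '' E i
  next : ∀ i, ∀ S : Set (ℍ × ℍ),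
    (IsSide k S ∧ S ≠ sideSet k (g i : Gam k)⁻¹ ∧ E (i + 1) ⊆ S) ↔ S = sideSet k (g (i + 1))
  periodic : ∀ i, E (i + n) = E i ∧ g (i + n) = g i
  distinct : ∀ i < n, ∀ j < n,
    E i = E j → sideSet k (g i) = sideSet k (g j) → i = j

/-- The cycle relators `([g (n-1)] ⋯ [g 1] [g 0]) ^ m`, where `m` is the order of the element
`g (n-1) ⋯ g 1 g 0` of `Γ`. -/
def cycleRelators (k : ℕ) : Set (FreeGroup (Pairing k)) :=
  {w | ∃ (n : ℕ) (E : ℕ → Set (ℍ × ℍ)) (g : ℕ → Pairing k), IsCycle k n E g ∧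
    w = ((List.range n).map fun i => FreeGroup.of (g i)).reverse.prod ^
      orderOf ((List.range n).map fun i => (g i : Gam k)).reverse.prod}

end HilbertModular

end

/-!
Everything follows from one fact: only finitely many `γ ∈ Γ` satisfy `F ∩ γ(F) ≠ ∅`
(`finite_tile_meets`).

The fact itself is reduction theory. Dirichlet approximation over `R` (`exists_approx`, by the
pigeonhole principle) gives, for a point with small imaginary parts, a pair `(c, d)` with `c ≠ 0`
and `‖cZ + d‖ < 1`. As `R` is principal, `(c, d) = g (c₀, d₀)` with `(c₀, d₀)` coprime, and
`‖c₀Z + d₀‖ ≤ ‖cZ + d‖` because the norm of `g` is a non-zero integer. Such a point is not in `F`,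
so that the height `y₁ y₂` is bounded below on `F` (`exists_pos_le_heightProd`). An element `A`
divides the height of `Z` by `‖cZ + d‖`, where `(c, d)` is its bottom row, so a point of `F` has
maximal height in its orbit. If `Z` and `AZ` are both in `F`, their heights agree, and since the
ratios `y₁ / y₂` are bounded, each of the two factors of `‖cZ + d‖` is bounded
(`normSq_factor_le`). Together with the lower bound for the height and the boundedness of `x₁`
and `x₂`, this bounds `c`, `d` and their conjugates. Using `A⁻¹`, the same holds for the upper
left entry, and the last entry is determined by the others if `c ≠ 0` and bounded if `c = 0`.
Since `R` is discrete in `ℝ²`, only finitely many `A` remain.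

The tiles containing a cell of `F` all meet `F`, so there are finitely many cells, sides and
pairing transformations. All members `E i` of a cycle are intersections of tiles contained in `F`,
hence belong to a finite set; as the pairs `(E i, S i)` within a period are distinct, the period is
bounded, and only finitely many words occur in the cycle relations.
-/

open UpperHalfPlane

noncomputable section

namespace HilbertModular

/-! ### Arithmetic of `R` in its two real embeddings -/

theorem emb_apply (k : ℕ) (a : QuadInt k) : emb k a = a.re + a.im * omegaR k := by
  simp [emb, QuadraticAlgebra.lift]

theorem emb'_apply (k : ℕ) (a : QuadInt k) : emb' k a = a.re + a.im * omegaR' k := by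
  simp [emb', QuadraticAlgebra.lift]

theorem kZero_pos (k : ℕ) : 0 < kZero k := by
  unfold kZero; split <;> norm_num

theorem irrational_sqrt_of_squarefree {k : ℕ} (hk : 1 < k) (hsq : Squarefree k) :
    Irrational √(k : ℝ) := by
  rw [irrational_sqrt_natCast_iff]
  rintro ⟨m, rfl⟩
  have := Nat.isUnit_iff.mp (hsq m dvd_rfl)
  subst this
  omega

theorem eq_zero_of_add_mul_irrational {x : ℝ} (hx : Irrational x) {p q : ℤ}
    (h : (p : ℝ) + q * x = 0) : q = 0 := by
  by_contra hq
  refine hx ⟨-p / q, ?_⟩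
  have hq' : (q : ℝ) ≠ 0 := by exact_mod_cast hq
  push_cast
  field_simp
  linarith

theorem omegaR'_lt_omegaR {k : ℕ} (hk : 1 < k) : omegaR' k < omegaR k := by
  have h0 : (0 : ℝ) < kZero k := by exact_mod_cast kZero_pos k
  have hs : 0 < √(k : ℝ) := Real.sqrt_pos.mpr (by positivity)
  unfold omegaR omegaR'
  gcongr
  linarith

theorem emb_ne_zero {k : ℕ} (hk : 1 < k) (hsq : Squarefree k) {a : QuadInt k} (ha : a ≠ 0) :
    emb k a ≠ 0 := by
  intro h
  have h0 : (kZero k : ℝ) ≠ 0 := by exact_mod_cast (kZero_pos k).ne'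
  rw [emb_apply, omegaR] at h
  field_simp at h
  have him : a.im = 0 := eq_zero_of_add_mul_irrational (irrational_sqrt_of_squarefree hk hsq)
    (p := a.re * kZero k + a.im) (by push_cast; linarith)
  refine ha (QuadraticAlgebra.ext ?_ him)
  simpa [him, h0] using h

theorem emb'_ne_zero {k : ℕ} (hk : 1 < k) (hsq : Squarefree k) {a : QuadInt k} (ha : a ≠ 0) :
    emb' k a ≠ 0 := by
  intro h
  have h0 : (kZero k : ℝ) ≠ 0 := by exact_mod_cast (kZero_pos k).ne'
  rw [emb'_apply, omegaR'] at h
  field_simp at h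
  have him : -a.im = 0 := eq_zero_of_add_mul_irrational (irrational_sqrt_of_squarefree hk hsq)
    (p := a.re * kZero k + a.im) (by push_cast; linarith)
  rw [neg_eq_zero] at him
  refine ha (QuadraticAlgebra.ext ?_ him)
  simpa [him, h0] using h

theorem exists_int_eq_emb_mul_emb' {k : ℕ} (hk : 1 < k) (a : QuadInt k) :
    ∃ n : ℤ, emb k a * emb' k a = n := by
  obtain ⟨p, q, h1, h2⟩ : ∃ p q : ℤ, omegaR k * omegaR k = p + q * omegaR k ∧
      omegaR' k * omegaR' k = p + q * omegaR' k :=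
    ⟨_, _, by simpa only [zsmul_eq_mul, mul_one] using omegaR_mul_self k,
      by simpa only [zsmul_eq_mul, mul_one] using omegaR'_mul_self k⟩
  -- `ω` and `ω'` are the two roots of `X² = q X + p`, so their sum is `q` and their product `-p`
  have hsum : omegaR k + omegaR' k = q :=
    mul_left_cancel₀ (sub_ne_zero.mpr (omegaR'_lt_omegaR hk).ne') (by linarith)
  have hprod : omegaR k * omegaR' k = -p := by
    rw [eq_sub_of_add_eq' hsum]; linarith
  refine ⟨a.re ^ 2 + a.re * a.im * q - a.im ^ 2 * p, ?_⟩
  rw [emb_apply, emb'_apply]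
  push_cast
  linear_combination (a.re : ℝ) * a.im * hsum + (a.im : ℝ) ^ 2 * hprod

theorem one_le_sq_emb_mul_emb' {k : ℕ} (hk : 1 < k) (hsq : Squarefree k) {a : QuadInt k}
    (ha : a ≠ 0) : 1 ≤ (emb k a * emb' k a) ^ 2 := by
  obtain ⟨n, hn⟩ := exists_int_eq_emb_mul_emb' hk a
  have hne : n ≠ 0 := by
    rintro rfl
    exact mul_ne_zero (emb_ne_zero hk hsq ha) (emb'_ne_zero hk hsq ha) (by simpa using hn)
  rw [hn]
  exact_mod_cast (pow_pos (abs_pos.mpr hne) 2).trans_eq (sq_abs n)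

/-- The image of `R` in `ℝ²` under the two embeddings is discrete. -/
theorem finite_abs_emb_le {k : ℕ} (hk : 1 < k) (B : ℝ) :
    {a : QuadInt k | |emb k a| ≤ B ∧ |emb' k a| ≤ B}.Finite := by
  have hw := sub_pos.mpr (omegaR'_lt_omegaR hk)
  set D := omegaR k - omegaR' k with hD
  set N := ⌈(B + B) / D⌉
  set N' := ⌈B + (B + B) / D * |omegaR k|⌉
  refine (((Set.finite_Icc (-N') N').prod (Set.finite_Icc (-N) N)).image
    fun p : ℤ × ℤ => (⟨p.1, p.2⟩ : QuadInt k)).subset ?_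
  rintro a ⟨h1, h2⟩
  have him : |(a.im : ℝ)| ≤ (B + B) / D := by
    rw [le_div_iff₀ hw]
    calc |(a.im : ℝ)| * D = |emb k a - emb' k a| := by
          rw [show emb k a - emb' k a = a.im * D by rw [emb_apply, emb'_apply, hD]; ring, abs_mul,
            abs_of_pos hw]
      _ ≤ B + B := (abs_sub _ _).trans (add_le_add h1 h2)
  have hre : |(a.re : ℝ)| ≤ B + (B + B) / D * |omegaR k| := by
    calc |(a.re : ℝ)| = |emb k a - a.im * omegaR k| := by rw [emb_apply]; congr 1; ring
      _ ≤ |emb k a| + |a.im * omegaR k| := abs_sub _ _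
      _ ≤ _ := by rw [abs_mul]; gcongr
  have him' : |a.im| ≤ N := by exact_mod_cast him.trans (Int.le_ceil _)
  have hre' : |a.re| ≤ N' := by exact_mod_cast hre.trans (Int.le_ceil _)
  exact ⟨(a.re, a.im), ⟨abs_le.mp hre', abs_le.mp him'⟩, rfl⟩

/-- A constant bounding `|s + t ω|` and `|s + t ω'|` for `|s|, |t| ≤ 1`. -/
def latticeBound (k : ℕ) : ℝ := 1 + |omegaR k| + |omegaR' k|

theorem abs_add_mul_omegaR_le (k : ℕ) {s t M : ℝ} (hs : |s| ≤ M) (ht : |t| ≤ M) :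
    |s + t * omegaR k| ≤ M * latticeBound k := by
  have hM := (abs_nonneg s).trans hs
  calc |s + t * omegaR k| ≤ |s| + |t| * |omegaR k| := by rw [← abs_mul]; exact abs_add_le _ _
    _ ≤ M + M * |omegaR k| := by gcongr
    _ ≤ _ := by unfold latticeBound; nlinarith [mul_nonneg hM (abs_nonneg (omegaR' k))]

theorem abs_add_mul_omegaR'_le (k : ℕ) {s t M : ℝ} (hs : |s| ≤ M) (ht : |t| ≤ M) :
    |s + t * omegaR' k| ≤ M * latticeBound k := by
  have hM := (abs_nonneg s).trans hs
  calc |s + t * omegaR' k| ≤ |s| + |t| * |omegaR' k| := by rw [← abs_mul]; exact abs_add_le _ _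
    _ ≤ M + M * |omegaR' k| := by gcongr
    _ ≤ _ := by unfold latticeBound; nlinarith [mul_nonneg hM (abs_nonneg (omegaR k))]

/-- The pair `(ω, 1), (ω', 1)` of linear forms is invertible: every `(a, b) ∈ ℝ²` is
`(s + t ω, s + t ω')` for some real `s` and `t`. -/
theorem exists_lattice_coords {k : ℕ} (hk : 1 < k) (a b : ℝ) :
    ∃ s t : ℝ, s + t * omegaR k = a ∧ s + t * omegaR' k = b := by
  have hw := (sub_pos.mpr (omegaR'_lt_omegaR hk)).ne'
  refine ⟨a - (a - b) / (omegaR k - omegaR' k) * omegaR k, (a - b) / (omegaR k - omegaR' k),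
    by ring, ?_⟩
  field_simp
  ring

/-- Simultaneous Dirichlet approximation over `R`, by the pigeonhole principle: the `(Q + 1)²`
multipliers `i + j ω` with `0 ≤ i, j ≤ Q` move `(x₁, x₂)` into only `Q²` boxes modulo `R`. -/
theorem exists_approx {k : ℕ} (hk : 1 < k) (x₁ x₂ : ℝ) {Q : ℕ} (hQ : 0 < Q) :
    ∃ c d : QuadInt k, c ≠ 0 ∧
      |emb k c| ≤ Q * latticeBound k ∧ |emb' k c| ≤ Q * latticeBound k ∧
      |emb k c * x₁ + emb k d| ≤ 1 / Q * latticeBound k ∧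
      |emb' k c * x₂ + emb' k d| ≤ 1 / Q * latticeBound k := by
  have hQ' : (0 : ℝ) < Q := by exact_mod_cast hQ
  choose s t hs ht using fun p : ℤ × ℤ =>
    exists_lattice_coords hk ((p.1 + p.2 * omegaR k) * x₁) ((p.1 + p.2 * omegaR' k) * x₂)
  have hbox : ∀ x : ℝ, ⌊Int.fract x * Q⌋ ∈ Finset.Ico (0 : ℤ) Q := fun x => by
    rw [Finset.mem_Ico, Int.le_floor, Int.floor_lt]
    push_cast
    exact ⟨mul_nonneg (Int.fract_nonneg x) hQ'.le,
      by nlinarith [Int.fract_lt_one x]⟩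
  have hclose : ∀ x y : ℝ, ⌊Int.fract x * Q⌋ = ⌊Int.fract y * Q⌋ →
      |Int.fract x - Int.fract y| ≤ 1 / Q := fun x y h => by
    have := Int.abs_sub_lt_one_of_floor_eq_floor h
    rw [← sub_mul, abs_mul, abs_of_pos hQ'] at this
    exact (le_div_iff₀ hQ').mpr this.le
  obtain ⟨p, hp, q, hq, hne, heq⟩ := Finset.exists_ne_map_eq_of_card_lt_of_maps_to
    (s := Finset.Icc (0 : ℤ) Q ×ˢ Finset.Icc (0 : ℤ) Q)
    (t := Finset.Ico (0 : ℤ) Q ×ˢ Finset.Ico (0 : ℤ) Q)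
    (f := fun p => (⌊Int.fract (s p) * Q⌋, ⌊Int.fract (t p) * Q⌋))
    (by
      simp only [Finset.card_product, Int.card_Icc, Int.card_Ico, sub_zero, Int.toNat_natCast]
      have : ((Q : ℤ) + 1).toNat = Q + 1 := by omega
      rw [this]
      nlinarith)
    (fun p _ => Finset.mem_product.mpr ⟨hbox _, hbox _⟩)
  rw [Prod.mk.injEq] at heq
  simp only [Finset.mem_product, Finset.mem_Icc] at hp hq
  have hcast : ∀ i j : ℤ, 0 ≤ i → i ≤ Q → 0 ≤ j → j ≤ Q → |((i - j : ℤ) : ℝ)| ≤ Q := by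
    intro i j h1 h2 h3 h4
    have : |i - j| ≤ (Q : ℤ) := abs_le.mpr ⟨by omega, by omega⟩
    exact_mod_cast this
  have h1 := hcast p.1 q.1 hp.1.1 hp.1.2 hq.1.1 hq.1.2
  have h2 := hcast p.2 q.2 hp.2.1 hp.2.2 hq.2.1 hq.2.2
  refine ⟨⟨p.1 - q.1, p.2 - q.2⟩, ⟨⌊s q⌋ - ⌊s p⌋, ⌊t q⌋ - ⌊t p⌋⟩, ?_, ?_, ?_, ?_, ?_⟩
  · intro h
    rw [QuadraticAlgebra.ext_iff] at h
    exact hne (Prod.ext (sub_eq_zero.mp h.1) (sub_eq_zero.mp h.2))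
  · rw [emb_apply]
    exact abs_add_mul_omegaR_le k h1 h2
  · rw [emb'_apply]
    exact abs_add_mul_omegaR'_le k h1 h2
  · convert abs_add_mul_omegaR_le k (hclose _ _ heq.1) (hclose _ _ heq.2) using 2
    rw [emb_apply, emb_apply]
    push_cast
    simp only [Int.fract]
    linear_combination hs q - hs p
  · convert abs_add_mul_omegaR'_le k (hclose _ _ heq.1) (hclose _ _ heq.2) using 2
    rw [emb'_apply, emb'_apply]
    push_cast
    simp only [Int.fract]
    linear_combination ht q - ht p

/-- In a principal ideal ring of real quadratic integers, every `(c, d)` with `c ≠ 0` is a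
multiple of a coprime pair. -/
theorem exists_eq_mul_isCoprime {k : ℕ} (hk : 1 < k) (hsq : Squarefree k)
    (hR : IsPrincipalIdealRing (QuadInt k)) {c : QuadInt k} (hc : c ≠ 0) (d : QuadInt k) :
    ∃ g c₀ d₀ : QuadInt k, g ≠ 0 ∧ c = g * c₀ ∧ d = g * d₀ ∧ IsCoprime c₀ d₀ := by
  obtain ⟨g, hg⟩ := hR.principal (Ideal.span {c, d})
  have hg' : Ideal.span {c, d} = Ideal.span {g} := hg
  obtain ⟨c₀, hc₀⟩ := Ideal.mem_span_singleton.mp (hg' ▸ Ideal.subset_span (by simp) :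
    c ∈ Ideal.span {g})
  obtain ⟨d₀, hd₀⟩ := Ideal.mem_span_singleton.mp (hg' ▸ Ideal.subset_span (by simp) :
    d ∈ Ideal.span {g})
  have hg0 : g ≠ 0 := by
    rintro rfl
    exact hc (by simpa using hc₀)
  obtain ⟨u, v, huv⟩ := Ideal.mem_span_pair.mp (hg' ▸ Ideal.mem_span_singleton_self g :
    g ∈ Ideal.span {c, d})
  refine ⟨g, c₀, d₀, hg0, hc₀, hd₀, u, v, ?_⟩
  by_contra hne
  have hmul : g * (u * c₀ + v * d₀ - 1) = 0 := by
    have e : u * (g * c₀) + v * (g * d₀) = g := by rw [← hc₀, ← hd₀]; exact huv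
    linear_combination e
  have := congrArg (emb k) hmul
  rw [map_mul, map_zero] at this
  exact mul_ne_zero (emb_ne_zero hk hsq hg0) (emb_ne_zero hk hsq (sub_ne_zero.mpr hne)) this

/-! ### The action of `SL₂(R)` and the size of the imaginary parts on `F` -/

theorem im_smul_mul (g : Matrix.SpecialLinearGroup (Fin 2) ℝ) (z : ℍ) :
    (g • z).im * ((g 1 0 * z.re + g 1 1) ^ 2 + g 1 0 ^ 2 * z.im ^ 2) = z.im := by
  have hne := UpperHalfPlane.denom_ne_zero (g : GL (Fin 2) ℝ) z
  have hsq : Complex.normSq (UpperHalfPlane.denom (g : GL (Fin 2) ℝ) z) =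
      (g 1 0 * z.re + g 1 1) ^ 2 + g 1 0 ^ 2 * z.im ^ 2 := by
    simp [UpperHalfPlane.denom, Complex.normSq_apply]
    ring
  have him : (g • z).im = z.im / Complex.normSq (UpperHalfPlane.denom (g : GL (Fin 2) ℝ) z) :=
    (UpperHalfPlane.im_smul_eq_div_normSq (g : GL (Fin 2) ℝ) z).trans (by simp)
  rw [← hsq, him, div_mul_cancel₀]
  exact (Complex.normSq_pos.mpr hne).ne'

theorem re_smul_mul_of_lower_left_eq_zero (g : Matrix.SpecialLinearGroup (Fin 2) ℝ)
    (hg : g 1 0 = 0) (z : ℍ) : (g • z).re * g 1 1 = g 0 0 * z.re + g 0 1 := by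
  have hdet := g.det_coe
  rw [Matrix.det_fin_two, hg, mul_zero, sub_zero] at hdet
  have hd : g 1 1 ≠ 0 := right_ne_zero_of_mul_eq_one hdet
  rw [← UpperHalfPlane.coe_re, UpperHalfPlane.coe_specialLinearGroup_apply]
  simp only [hg, Algebra.algebraMap_self, RingHom.id_apply, Complex.ofReal_zero, zero_mul, zero_add,
    Complex.div_ofReal_re]
  rw [div_mul_cancel₀ _ hd]
  simp

/-- The product `y₁ y₂` of the two imaginary parts. -/
def heightProd (Z : ℍ × ℍ) : ℝ := Z.1.im * Z.2.im

theorem heightProd_pos (Z : ℍ × ℍ) : 0 < heightProd Z := mul_pos Z.1.im_pos Z.2.im_pos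

theorem heightProd_actSL_mul (k : ℕ) (A : Matrix.SpecialLinearGroup (Fin 2) (QuadInt k))
    (Z : ℍ × ℍ) : heightProd (actSL k A Z) * normCD k (A 1 0) (A 1 1) Z = heightProd Z := by
  have h1 := im_smul_mul (Matrix.SpecialLinearGroup.map (emb k) A) Z.1
  have h2 := im_smul_mul (Matrix.SpecialLinearGroup.map (emb' k) A) Z.2
  unfold heightProd
  conv_rhs => rw [← h1, ← h2]
  simp [normCD, actSL]
  ring

theorem isCoprime_bottom_row {S : Type*} [CommRing S]
    (A : Matrix.SpecialLinearGroup (Fin 2) S) : IsCoprime (A 1 0) (A 1 1) :=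
  ⟨-A 0 1, A 0 0, by
    have := A.det_coe
    rw [Matrix.det_fin_two] at this
    linear_combination this⟩

theorem heightProd_actSL_le {k : ℕ} (A : Matrix.SpecialLinearGroup (Fin 2) (QuadInt k))
    {Z : ℍ × ℍ} (hZ : Z ∈ FDom k) : heightProd (actSL k A Z) ≤ heightProd Z := by
  rw [← heightProd_actSL_mul k A Z]
  exact le_mul_of_one_le_right (heightProd_pos _).le (hZ.2 _ _ (isCoprime_bottom_row A))

theorem im_le_of_mem_FInf {k : ℕ} {Z : ℍ × ℍ} (hZ : Z ∈ FInf k) :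
    Z.1.im ≤ fundUnit k ^ 2 * Z.2.im ∧ Z.2.im ≤ fundUnit k ^ 2 * Z.1.im := by
  obtain ⟨-, -, h1, h2⟩ := hZ
  have hy1 := Z.1.im_pos
  have hy2 := Z.2.im_pos
  have hM : 0 < fundUnit k ^ 2 := (div_pos hy1 hy2).trans_le h2
  refine ⟨(div_le_iff₀ hy2).mp h2, ?_⟩
  rw [ratio, le_div_iff₀ hy2, inv_mul_le_iff₀ hM] at h1
  exact h1

theorem one_le_fundUnit_sq {k : ℕ} {Z : ℍ × ℍ} (hZ : Z ∈ FInf k) : 1 ≤ fundUnit k ^ 2 := by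
  obtain ⟨h1, h2⟩ := im_le_of_mem_FInf hZ
  have hy1 := Z.1.im_pos
  have hy2 := Z.2.im_pos
  by_contra! h
  nlinarith

theorem abs_re_le_of_mem_FInf {k : ℕ} (hk : 1 < k) {Z : ℍ × ℍ} (hZ : Z ∈ FInf k) :
    |Z.1.re| ≤ latticeBound k ∧ |Z.2.re| ≤ latticeBound k := by
  obtain ⟨h1, h2, -, -⟩ := hZ
  have hw : omegaR k - omegaR' k ≠ 0 := (sub_pos.mpr (omegaR'_lt_omegaR hk)).ne'
  have hs : |sOne k Z| ≤ 1 := h1.trans (by norm_num)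
  have ht : |sTwo k Z| ≤ 1 := h2.trans (by norm_num)
  have e1 : sOne k Z + sTwo k Z * omegaR k = Z.1.re := by
    have : sOne k Z = -(omegaR' k * Z.1.re - omegaR k * Z.2.re) / (omegaR k - omegaR' k) := by
      rw [sOne, ← neg_sub (omegaR k), div_neg, neg_div]
    rw [this, sTwo]
    field_simp
    ring
  have e2 : sOne k Z + sTwo k Z * omegaR' k = Z.2.re := by
    have : sTwo k Z * (omegaR k - omegaR' k) = Z.1.re - Z.2.re := div_mul_cancel₀ _ hw
    linarith
  have b1 := abs_add_mul_omegaR_le k hs ht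
  have b2 := abs_add_mul_omegaR'_le k hs ht
  rw [e1, one_mul] at b1
  rw [e2, one_mul] at b2
  exact ⟨b1, b2⟩

theorem one_le_latticeBound (k : ℕ) : 1 ≤ latticeBound k := by
  unfold latticeBound
  linarith [abs_nonneg (omegaR k), abs_nonneg (omegaR' k)]

/-- For `R` principal, the product `y₁ y₂` is bounded away from `0` on `F`. For a fixed large `Q`,
Dirichlet's approximation gives `(c, d)` with `‖cZ + d‖ < 1` as soon as `y₁` and `y₂` are small;
dividing out a greatest common divisor makes `(c, d)` coprime without increasing the norm. -/
theorem exists_pos_le_heightProd {k : ℕ} (hk : 1 < k) (hsq : Squarefree k)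
    (hR : IsPrincipalIdealRing (QuadInt k)) :
    ∃ δ : ℝ, 0 < δ ∧ ∀ Z ∈ FDom k, δ ≤ heightProd Z := by
  set B := latticeBound k
  have hB : 1 ≤ B := one_le_latticeBound k
  obtain ⟨Q, hQ⟩ := exists_nat_gt (2 * B)
  have hQ0 : (0 : ℝ) < Q := by linarith
  rcases (FDom k).eq_empty_or_nonempty with he | ⟨Z₀, hZ₀⟩
  · exact ⟨1, one_pos, by simp [he]⟩
  set M := fundUnit k ^ 2 with hMdef
  have hM : 1 ≤ M := one_le_fundUnit_sq hZ₀.1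
  refine ⟨1 / (2 * (Q * B) ^ 2 * M), by positivity, fun Z hZ => ?_⟩
  obtain ⟨c, d, hc, hc1, hc2, hd1, hd2⟩ :=
    exists_approx hk Z.1.re Z.2.re (Nat.cast_pos.mp hQ0)
  obtain ⟨g, c₀, d₀, hg, rfl, rfl, hcop⟩ := exists_eq_mul_isCoprime hk hsq hR hc d
  have hnorm : normCD k (g * c₀) (g * d₀) Z = (emb k g * emb' k g) ^ 2 * normCD k c₀ d₀ Z := by
    simp only [normCD, map_mul]
    ring
  have h1 : 1 ≤ normCD k (g * c₀) (g * d₀) Z := by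
    rw [hnorm]
    exact one_le_mul_of_one_le_of_one_le (one_le_sq_emb_mul_emb' hk hsq hg) (hZ.2 _ _ hcop)
  obtain ⟨hy1, hy2⟩ := im_le_of_mem_FInf hZ.1
  set X := 1 / 4 + (Q * B) ^ 2 * (M * heightProd Z) with hX
  have hquarter : (1 / Q * B) ^ 2 ≤ 1 / 4 := by
    have h0 : 1 / Q * B ≤ 1 / 2 := by
      rw [one_div_mul_eq_div, div_le_iff₀ hQ0]
      linarith
    have : 0 ≤ 1 / Q * B := by positivity
    nlinarith
  have hfactor : ∀ u v y : ℝ, |u| ≤ 1 / Q * B → |v| ≤ Q * B → y ^ 2 ≤ M * heightProd Z →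
      u ^ 2 + v ^ 2 * y ^ 2 ≤ X := by
    intro u v y hu hv hy
    have hu2 : u ^ 2 ≤ (1 / Q * B) ^ 2 := sq_le_sq' (abs_le.mp hu).1 (abs_le.mp hu).2
    have hv2 : v ^ 2 ≤ (Q * B) ^ 2 := sq_le_sq' (abs_le.mp hv).1 (abs_le.mp hv).2
    rw [hX]
    have := mul_le_mul hv2 hy (sq_nonneg y) (sq_nonneg _)
    linarith
  have f1 := hfactor _ _ Z.1.im hd1 hc1
    (by unfold heightProd; nlinarith [Z.1.im_pos])
  have f2 := hfactor _ _ Z.2.im hd2 hc2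
    (by unfold heightProd; nlinarith [Z.2.im_pos])
  have hX0 : 0 ≤ X := by have := heightProd_pos Z; positivity
  have hXX : 1 ≤ X * X := h1.trans (mul_le_mul f1 f2 (by positivity) hX0)
  have hX1 : 1 ≤ X := by nlinarith
  rw [div_le_iff₀ (by positivity)]
  rw [hX] at hX1
  linarith

/-! ### Only finitely many `γ ∈ Γ` satisfy `F ∩ γ(F) ≠ ∅` -/

/-- If `Z` and `A Z` both lie in `F`, the two factors of `‖cZ + d‖`, with `(c, d)` the bottom row
of `A`, are bounded. By maximality of the height `y₁ y₂` on `F`, `Z` and `A Z` have the same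
height, so that bounded ratios `y₁ / y₂` force the single imaginary parts to be comparable. -/
theorem normSq_factor_le {k : ℕ} {A : Matrix.SpecialLinearGroup (Fin 2) (QuadInt k)}
    {Z : ℍ × ℍ} (hZ : Z ∈ FDom k) (hA : actSL k A Z ∈ FDom k) :
    (emb k (A 1 0) * Z.1.re + emb k (A 1 1)) ^ 2 + emb k (A 1 0) ^ 2 * Z.1.im ^ 2
        ≤ fundUnit k ^ 2 ∧
      (emb' k (A 1 0) * Z.2.re + emb' k (A 1 1)) ^ 2 + emb' k (A 1 0) ^ 2 * Z.2.im ^ 2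
        ≤ fundUnit k ^ 2 := by
  have hheight : heightProd (actSL k A Z) = heightProd Z := by
    refine (heightProd_actSL_le A hZ).antisymm ?_
    have := heightProd_actSL_le A⁻¹ hA
    rwa [map_inv, Equiv.Perm.inv_def, Equiv.symm_apply_apply] at this
  have hM := one_le_fundUnit_sq hZ.1
  have key : ∀ {M y₁ y₂ v₁ v₂ q : ℝ}, 1 ≤ M → 0 < y₁ → 0 < v₁ → 0 < v₂ → 0 < y₂ →
      y₁ ≤ M * y₂ → v₂ ≤ M * v₁ → v₁ * v₂ = y₁ * y₂ → v₁ * q = y₁ → q ≤ M := by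
    intro M y₁ y₂ v₁ v₂ q hM hy₁ hv₁ hv₂ hy₂ h1 h2 h3 h4
    have h5 : y₁ ^ 2 ≤ (M * v₁) ^ 2 := by
      calc y₁ ^ 2 ≤ y₁ * (M * y₂) := by nlinarith
        _ = M * (v₁ * v₂) := by rw [h3]; ring
        _ ≤ M * (v₁ * (M * v₁)) := by gcongr
        _ = (M * v₁) ^ 2 := by ring
    have h6 : y₁ ≤ M * v₁ := le_of_sq_le_sq h5 (by positivity)
    refine le_of_mul_le_mul_left ?_ hv₁
    rw [h4]
    linarith
  obtain ⟨hy1, hy2⟩ := im_le_of_mem_FInf hZ.1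
  obtain ⟨hv1, hv2⟩ := im_le_of_mem_FInf hA.1
  refine ⟨key hM Z.1.im_pos (actSL k A Z).1.im_pos (actSL k A Z).2.im_pos Z.2.im_pos hy1 hv2
    hheight ?_, key hM Z.2.im_pos (actSL k A Z).2.im_pos (actSL k A Z).1.im_pos Z.1.im_pos hy2 hv1
    ((mul_comm _ _).trans (hheight.trans (mul_comm _ _))) ?_⟩
  · exact im_smul_mul (Matrix.SpecialLinearGroup.map (emb k) A) Z.1
  · exact im_smul_mul (Matrix.SpecialLinearGroup.map (emb' k) A) Z.2

theorem exists_bound_bottom_row {k : ℕ} (hk : 1 < k) (hsq : Squarefree k)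
    (hR : IsPrincipalIdealRing (QuadInt k)) :
    ∃ B : ℝ, ∀ (A : Matrix.SpecialLinearGroup (Fin 2) (QuadInt k)) (Z : ℍ × ℍ),
      Z ∈ FDom k → actSL k A Z ∈ FDom k →
      (|emb k (A 1 0)| ≤ B ∧ |emb' k (A 1 0)| ≤ B) ∧
        (|emb k (A 1 1)| ≤ B ∧ |emb' k (A 1 1)| ≤ B) := by
  obtain ⟨δ, hδ, hheight⟩ := exists_pos_le_heightProd hk hsq hR
  set M := fundUnit k ^ 2 with hM
  set C := √(M ^ 2 / δ) with hC
  refine ⟨M + C * latticeBound k, fun A Z hZ hA => ?_⟩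
  have hM1 : 1 ≤ M := one_le_fundUnit_sq hZ.1
  have hB := one_le_latticeBound k
  have hC0 : 0 ≤ C := Real.sqrt_nonneg _
  have key : ∀ {x y c d : ℝ}, (c * x + d) ^ 2 + c ^ 2 * y ^ 2 ≤ M → |x| ≤ latticeBound k →
      heightProd Z ≤ M * y ^ 2 →
      |c| ≤ M + C * latticeBound k ∧ |d| ≤ M + C * latticeBound k := by
    intro x y c d h hx hy
    have h1 : |c * x + d| ≤ M := abs_le_of_sq_le_sq (by nlinarith [sq_nonneg (c * y)]) (by linarith)
    have h2 : |c| ≤ C := by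
      refine Real.abs_le_sqrt ?_
      rw [le_div_iff₀ hδ]
      calc c ^ 2 * δ ≤ c ^ 2 * (M * y ^ 2) := by gcongr; exact (hheight Z hZ).trans hy
        _ = M * (c ^ 2 * y ^ 2) := by ring
        _ ≤ M * M := by gcongr; nlinarith [sq_nonneg (c * x + d)]
        _ = M ^ 2 := by ring
    refine ⟨by nlinarith, ?_⟩
    calc |d| = |(c * x + d) - c * x| := by congr 1; ring
      _ ≤ |c * x + d| + |c * x| := abs_sub _ _
      _ ≤ M + C * latticeBound k := by rw [abs_mul]; gcongr
  obtain ⟨f1, f2⟩ := normSq_factor_le hZ hA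
  obtain ⟨hx1, hx2⟩ := abs_re_le_of_mem_FInf hk hZ.1
  obtain ⟨hy1, hy2⟩ := im_le_of_mem_FInf hZ.1
  obtain ⟨c1, d1⟩ := key f1 hx1 (by unfold heightProd; nlinarith [Z.1.im_pos])
  obtain ⟨c2, d2⟩ := key f2 hx2 (by unfold heightProd; nlinarith [Z.2.im_pos])
  exact ⟨⟨c1, c2⟩, d1, d2⟩

theorem exists_bound_upper_right {k : ℕ} (hk : 1 < k) (B : ℝ) :
    ∃ B' : ℝ, ∀ (A : Matrix.SpecialLinearGroup (Fin 2) (QuadInt k)) (Z : ℍ × ℍ),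
      Z ∈ FInf k → actSL k A Z ∈ FInf k → A 1 0 = 0 →
      (|emb k (A 0 0)| ≤ B ∧ |emb' k (A 0 0)| ≤ B) →
      (|emb k (A 1 1)| ≤ B ∧ |emb' k (A 1 1)| ≤ B) →
      |emb k (A 0 1)| ≤ B' ∧ |emb' k (A 0 1)| ≤ B' := by
  refine ⟨latticeBound k * B + B * latticeBound k, fun A Z hZ hA h0 ha hd => ?_⟩
  have hB := one_le_latticeBound k
  have key : ∀ {w d a x b : ℝ}, w * d = a * x + b → |w| ≤ latticeBound k → |d| ≤ B → |a| ≤ B →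
      |x| ≤ latticeBound k → |b| ≤ latticeBound k * B + B * latticeBound k := by
    intro w d a x b h hw hd ha hx
    have hB0 : 0 ≤ B := (abs_nonneg d).trans hd
    calc |b| = |w * d - a * x| := by rw [h]; congr 1; ring
      _ ≤ |w * d| + |a * x| := abs_sub _ _
      _ ≤ _ := by rw [abs_mul, abs_mul]; gcongr
  obtain ⟨hx1, hx2⟩ := abs_re_le_of_mem_FInf hk hZ
  obtain ⟨hw1, hw2⟩ := abs_re_le_of_mem_FInf hk hA
  refine ⟨key ?_ hw1 hd.1 ha.1 hx1, key ?_ hw2 hd.2 ha.2 hx2⟩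
  · exact re_smul_mul_of_lower_left_eq_zero (Matrix.SpecialLinearGroup.map (emb k) A)
      (by simp [h0]) Z.1
  · exact re_smul_mul_of_lower_left_eq_zero (Matrix.SpecialLinearGroup.map (emb' k) A)
      (by simp [h0]) Z.2

theorem eq_of_entries_eq {S : Type*} [CommRing S] {A A' : Matrix.SpecialLinearGroup (Fin 2) S}
    (h00 : A 0 0 = A' 0 0) (h01 : A 0 1 = A' 0 1) (h10 : A 1 0 = A' 1 0)
    (h11 : A 1 1 = A' 1 1) : A = A' := by
  refine Subtype.ext (Matrix.ext fun i j => ?_)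
  fin_cases i <;> fin_cases j <;> assumption

theorem finite_actSL_meets {k : ℕ} (hk : 1 < k) (hsq : Squarefree k)
    (hR : IsPrincipalIdealRing (QuadInt k)) :
    {A : Matrix.SpecialLinearGroup (Fin 2) (QuadInt k) |
      ∃ Z ∈ FDom k, actSL k A Z ∈ FDom k}.Finite := by
  obtain ⟨B, hB⟩ := exists_bound_bottom_row hk hsq hR
  obtain ⟨B', hB'⟩ := exists_bound_upper_right hk B
  set T := {a : QuadInt k | |emb k a| ≤ B ∧ |emb' k a| ≤ B}
  set T' := {a : QuadInt k | |emb k a| ≤ B' ∧ |emb' k a| ≤ B'}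
  have hT : T.Finite := finite_abs_emb_le hk B
  have hT' : T'.Finite := finite_abs_emb_le hk B'
  have hbox : ∀ (A : Matrix.SpecialLinearGroup (Fin 2) (QuadInt k)) (Z : ℍ × ℍ),
      Z ∈ FDom k → actSL k A Z ∈ FDom k → A 0 0 ∈ T ∧ A 1 0 ∈ T ∧ A 1 1 ∈ T := by
    intro A Z hZ hA
    obtain ⟨hc, hd⟩ := hB A Z hZ hA
    -- the bottom row of `A⁻¹` is `(-c, a)`
    have hinv := (hB A⁻¹ (actSL k A Z) hA
      (by rwa [map_inv, Equiv.Perm.inv_def, Equiv.symm_apply_apply])).2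
    rw [Matrix.SpecialLinearGroup.SL2_inv_expl] at hinv
    exact ⟨hinv, hc, hd⟩
  have hdet : ∀ A : Matrix.SpecialLinearGroup (Fin 2) (QuadInt k),
      A 0 0 * A 1 1 - A 0 1 * A 1 0 = 1 := fun A => by
    rw [← Matrix.det_fin_two, A.det_coe]
  -- if `c ≠ 0`, then `b` is determined by `a`, `c`, `d`; if `c = 0`, it is bounded
  have hfin₁ : {A : Matrix.SpecialLinearGroup (Fin 2) (QuadInt k) |
      (A 0 0 ∈ T ∧ A 1 0 ∈ T ∧ A 1 1 ∈ T) ∧ A 1 0 ≠ 0}.Finite := by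
    refine Set.Finite.of_finite_image (f := fun A => (A 0 0, A 1 0, A 1 1))
      ((hT.prod (hT.prod hT)).subset ?_) ?_
    · rintro _ ⟨A, ⟨hA, -⟩, rfl⟩
      exact hA
    · rintro A ⟨-, hc⟩ A' - h
      simp only [Prod.mk.injEq] at h
      obtain ⟨h00, h10, h11⟩ := h
      have e := hdet A'
      rw [← h00, ← h10, ← h11] at e
      have h01 : A 0 1 = A' 0 1 := by
        by_contra hne
        have e' : (A 0 1 - A' 0 1) * A 1 0 = 0 := by
          linear_combination e - hdet A
        have := congrArg (emb k) e'
        rw [map_mul, map_zero] at this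
        exact mul_ne_zero (emb_ne_zero hk hsq (sub_ne_zero.mpr hne)) (emb_ne_zero hk hsq hc) this
      exact eq_of_entries_eq h00 h01 h10 h11
  have hfin₂ : {A : Matrix.SpecialLinearGroup (Fin 2) (QuadInt k) |
      (A 0 0 ∈ T ∧ A 1 0 ∈ T ∧ A 1 1 ∈ T) ∧ A 0 1 ∈ T'}.Finite := by
    refine Set.Finite.of_finite_image (f := fun A => (A 0 0, A 1 0, A 1 1, A 0 1))
      ((hT.prod (hT.prod (hT.prod hT'))).subset ?_) ?_
    · rintro _ ⟨A, ⟨⟨h1, h2, h3⟩, h4⟩, rfl⟩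
      exact ⟨h1, h2, h3, h4⟩
    · rintro A - A' - h
      simp only [Prod.mk.injEq] at h
      obtain ⟨h00, h10, h11, h01⟩ := h
      exact eq_of_entries_eq h00 h01 h10 h11
  refine (hfin₁.union hfin₂).subset ?_
  rintro A ⟨Z, hZ, hA⟩
  obtain ⟨ha, hc, hd⟩ := hbox A Z hZ hA
  by_cases h0 : A 1 0 = 0
  · exact Or.inr ⟨⟨ha, hc, hd⟩, hB' A Z hZ.1 hA.1 h0 ha hd⟩
  · exact Or.inl ⟨⟨ha, hc, hd⟩, h0⟩

/-- Finiteness of the set of `γ ∈ Γ` for which `γ(F)` meets `F`. -/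
theorem finite_tile_meets {k : ℕ} (hk : 1 < k) (hsq : Squarefree k)
    (hR : IsPrincipalIdealRing (QuadInt k)) :
    {γ : Gam k | (FDom k ∩ tile k γ).Nonempty}.Finite := by
  refine ((finite_actSL_meets hk hsq hR).image
    (QuotientGroup.mk : _ → Gam k)).subset ?_
  rintro γ ⟨_, hW, Z, hZ, rfl⟩
  obtain ⟨A, rfl⟩ := QuotientGroup.mk_surjective γ
  exact ⟨A, ⟨Z, hZ, hW⟩, rfl⟩

/-! ### Cells, sides, and cycles -/

theorem act_image_tile (k : ℕ) (γ δ : Gam k) : act k γ '' tile k δ = tile k (γ * δ) := by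
  rw [tile, tile, Set.image_image, map_mul]
  rfl

/-- The non-empty intersections of tiles that are contained in `F`. Unlike the dimension of a
cell, this notion is visibly invariant under `Γ`. -/
def tileIntersections (k : ℕ) : Set (Set (ℍ × ℍ)) :=
  {C | C.Nonempty ∧ (∃ I : Set (Gam k), I.Nonempty ∧ C = ⋂ γ ∈ I, tile k γ) ∧ C ⊆ FDom k}

theorem finite_tileIntersections {k : ℕ}
    (h : {γ : Gam k | (FDom k ∩ tile k γ).Nonempty}.Finite) : (tileIntersections k).Finite := by
  refine (h.finite_subsets.image fun I => ⋂ γ ∈ I, tile k γ).subset ?_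
  rintro _ ⟨⟨Z, hZ⟩, ⟨I, -, rfl⟩, hsub⟩
  exact ⟨I, fun γ hγ => ⟨Z, hsub hZ, Set.mem_iInter₂.mp hZ γ hγ⟩, rfl⟩

theorem act_image_mem_tileIntersections {k : ℕ} {C : Set (ℍ × ℍ)} (γ : Gam k)
    (hC : C ∈ tileIntersections k) (hsub : act k γ '' C ⊆ FDom k) :
    act k γ '' C ∈ tileIntersections k := by
  obtain ⟨hne, ⟨I, hI, rfl⟩, -⟩ := hC
  refine ⟨hne.image _, ⟨(γ * ·) '' I, hI.image _, ?_⟩, hsub⟩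
  rw [Set.biInter_image, Set.image_iInter₂ (act k γ).bijective]
  simp only [act_image_tile]

theorem IsCycle.mem_tileIntersections {k n : ℕ} {E : ℕ → Set (ℍ × ℍ)} {g : ℕ → Pairing k}
    (h : IsCycle k n E g) (i : ℕ) : E i ∈ tileIntersections k := by
  induction i with
  | zero => exact ⟨h.edge.1.1, h.edge.1.2.1, h.subset.trans Set.inter_subset_left⟩
  | succ i ih =>
    have hsub : E (i + 1) ⊆ sideSet k (g (i + 1)) := ((h.next i _).mpr rfl).2.2
    rw [h.image i] at hsub ⊢
    exact act_image_mem_tileIntersections _ ih (hsub.trans Set.inter_subset_left)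

theorem semialgDim_empty : semialgDim ∅ = ⊥ := by
  rw [semialgDim, Set.image_empty, MvPolynomial.vanishingIdeal_empty]
  exact ringKrullDim_eq_bot_of_subsingleton

theorem finite_isPairing {k : ℕ}
    (h : {γ : Gam k | (FDom k ∩ tile k γ).Nonempty}.Finite) : {γ : Gam k | IsPairing k γ}.Finite := by
  refine (h.image (·⁻¹)).subset ?_
  rintro γ ⟨-, hdim⟩
  refine ⟨γ⁻¹, ?_, inv_inv γ⟩
  rw [Set.mem_ofPred_eq, Set.nonempty_iff_ne_empty]
  intro h0
  rw [sideSet, h0, semialgDim_empty] at hdim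
  exact absurd hdim (by decide)

theorem finite_isSide {k : ℕ} (h : {γ : Gam k | IsPairing k γ}.Finite) :
    {S | IsSide k S}.Finite := by
  refine (h.image (sideSet k)).subset ?_
  rintro _ ⟨γ, hγ, rfl⟩
  exact ⟨γ, hγ, rfl⟩

theorem IsCycle.length_le {k n : ℕ} {E : ℕ → Set (ℍ × ℍ)} {g : ℕ → Pairing k}
    (h : IsCycle k n E g) (hfin : (tileIntersections k ×ˢ {S | IsSide k S}).Finite) :
    n ≤ hfin.toFinset.card := by
  rw [← Finset.card_range n]
  refine Finset.card_le_card_of_injOn (fun i => (E i, sideSet k (g i))) (fun i _ => ?_) ?_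
  · rw [Finset.mem_coe, Set.Finite.mem_toFinset]
    exact ⟨h.mem_tileIntersections i, g i, (g i).2, rfl⟩
  · intro i hi j hj hij
    rw [Prod.mk.injEq] at hij
    exact h.distinct i (by simpa using hi) j (by simpa using hj) hij.1 hij.2

theorem finite_pairingRelators {k : ℕ} [Finite (Pairing k)] : (pairingRelators k).Finite := by
  refine (Set.finite_range fun p : Pairing k × Pairing k =>
    FreeGroup.of p.1 * FreeGroup.of p.2).subset ?_
  rintro _ ⟨γ, δ, -, rfl⟩
  exact ⟨(γ, δ), rfl⟩

/-- A cycle relator depends only on the word `g 0, …, g (n - 1)`, whose length is bounded. -/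
theorem finite_cycleRelators {k : ℕ} [Finite (Pairing k)]
    (hfin : (tileIntersections k ×ˢ {S | IsSide k S}).Finite) : (cycleRelators k).Finite := by
  refine ((List.finite_length_le (Pairing k) hfin.toFinset.card).image fun l =>
    (l.map FreeGroup.of).reverse.prod ^ orderOf (l.map Subtype.val).reverse.prod).subset ?_
  rintro _ ⟨n, E, g, h, rfl⟩
  refine ⟨(List.range n).map g, by simpa using h.length_le hfin, ?_⟩
  simp only [List.map_map]
  rfl

theorem finite_tiles_meeting {k : ℕ}
    (h : {γ : Gam k | (FDom k ∩ tile k γ).Nonempty}.Finite) {T : Set (ℍ × ℍ)}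
    (hT : T ∈ tessellation k) : {T' ∈ tessellation k | T' ≠ T ∧ (T ∩ T').Nonempty}.Finite := by
  obtain ⟨γ, rfl⟩ := hT
  refine (h.image fun δ => tile k (γ * δ)).subset ?_
  rintro _ ⟨⟨δ, rfl⟩, -, W, ⟨Z, hZ, rfl⟩, hW⟩
  refine ⟨γ⁻¹ * δ, ⟨Z, hZ, ?_⟩, by simp only [mul_inv_cancel_left]⟩
  rw [← act_image_tile, map_inv]
  exact ⟨_, hW, Equiv.symm_apply_apply _ _⟩

end HilbertModular

end

open HilbertModular in
theorem mainTheorem5 (k : ℕ) (hk : 1 < k) (hsq : Squarefree k)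
    (hR : IsPrincipalIdealRing (QuadInt k)) :
    -- each tile meets only finitely many other tiles
    (∀ T ∈ tessellation k, {T' ∈ tessellation k | T' ≠ T ∧ (T ∩ T').Nonempty}.Finite) ∧
    -- `F` has finitely many cells, sides and edges
    {C | IsCell k C ∧ C ⊆ FDom k}.Finite ∧
    {S | IsSide k S}.Finite ∧
    {E | IsEdge k E ∧ E ⊆ FDom k}.Finite ∧
    -- the presentation has finitely many generators and relations
    Finite (Pairing k) ∧
    (pairingRelators k ∪ cycleRelators k).Finite := by
  have hmeet := finite_tile_meets hk hsq hR
  have hcells := finite_tileIntersections hmeet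
  have hpair := finite_isPairing hmeet
  have hsides := finite_isSide hpair
  have : Finite (Pairing k) := hpair
  refine ⟨fun T hT => finite_tiles_meeting hmeet hT,
    hcells.subset fun C hC => ⟨hC.1.1, hC.1.2.1, hC.2⟩, hsides,
    hcells.subset fun C hC => ⟨hC.1.1.1, hC.1.1.2.1, hC.2⟩, this,
    finite_pairingRelators.union (finite_cycleRelators (hcells.prod hsides))⟩
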